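/- Let $d\in\mathbb N$, let $|\cdot|$ denote the $\ell^1$ norm on $\mathbb Z^d$, and let $\beta,C,\lambda,R>0$ be real numbers such that \[ \gamma := e^{-2\beta C}-5\max(1,\beta\lambda)(2R)^d\left(e^{3\beta C}-1\right)>0 . \] Let $\Lambda\subset\mathbb Z^d$ be finite and $\Omega_\Lambda=\{-1,1\}^\Lambda$. For $f:\Omega_\Lambda\to\mathbb R$ and $i\in\Lambda$ put $\nabla_i f(\sigma)=f(\sigma^i)-f(\sigma)$, where $\sigma^i$ is $\sigma$ with the spin at $i$ flipped, and \[ \|f\|=\sup_{\sigma\in\Omega_\Lambda}|f(\sigma)|,\qquad |||f|||=\sum_{i\in\Lambda}\|\nabla_i f\|,\qquad \Lambda_f=\{i\in\Lambda:\|\nabla_i f\|>0\}. \] Let $H:\Omega_\Lambda\to\mathbb R$ and $(\lambda_i)_{i\in\Lambda}$ satisfy (BD) $|\nabla_iH(\sigma)|\le C$ for all $i\in\Lambda$, $\sigma\in\Omega_\Lambda$, and $0\le\lambda_i\le\lambda$ for all $i\in\Lambda$; (LOC) for every $i\in\Lambda$, $\nabla_iH(\sigma)=\nabla_iH(\eta)$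 whenever $\sigma_j=\eta_j$ for every $j\in\Lambda$ with $|j-i|\le R$. On $\bigotimes_{i\in\Lambda}\mathbb C^2$, with the orthonormal product basis $(|\sigma\rangle)_{\sigma\in\Omega_\Lambda}$, let $\mathcal F_f$ be the operator $\mathcal F_f|\sigma\rangle=f(\sigma)|\sigma\rangle$ (that is, $f$ evaluated at the Pauli operators $\hat\sigma^z_i$), let $\hat\sigma^x_i$ be the Pauli matrix $\begin{pmatrix}0&1\\1&0\end{pmatrix}$ acting at the site $i$, and let \[ \mathcal H=\mathcal F_H-\sum_{i\in\Lambda}\lambda_i\hat\sigma^x_i,\qquad \langle\mathcal F\rangle=\frac{\operatorname{Tr}(\mathcal F e^{-\beta\mathcal H})}{\operatorname{Tr}(e^{-\beta\mathcal H})},\qquad \langle\mathcal F;\mathcal G\rangle=\langle\mathcal F\mathcal G\rangle-\langle\mathcal F\rangle\langle\mathcal G\rangle . \] Then for all $f,g:\Omega_\Lambda\to\mathbb R$ \[ \left|\langle\mathcal F_f;\mathcal F_g\rangle\right|\le\left(\|f\|\,\|g\|+N\,|||f|||\,|||g|||\right)\exp\left[-\delta\,\mathrm{dist}(\Lambda_f,\Lambda_g)\right],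 \] where $\mathrm{dist}(\Lambda_f,\Lambda_g)=\min\{|i-j|:i\in\Lambda_f,\ j\in\Lambda_g\}$ (read as $0$ if $\Lambda_f$ or $\Lambda_g$ is empty), and the constants \[ N=\left(\frac{2}{1-e^{-1/R}}\right)^d,\qquad \delta=\frac1{2R}\min\left(\frac12,\frac{\gamma}{10\max(1,\lambda\beta)e^{\beta C+1}}\right) \] do not depend on $\Lambda$. -/

import Mathlib

noncomputable section

namespace TransverseField

/-- Classical spin configurations `{-1, 1}^Λ`; the two spin values are the units of `ℤ`. -/
abbrev Config {d : ℕ} (Λ : Finset (Fin d → ℤ)) : Type := Λ → ℤˣ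

/-- Operators on `⨂_{i ∈ Λ} ℂ²`, written as matrices in the orthonormal product basis `|σ⟩`. -/
abbrev Op {d : ℕ} (Λ : Finset (Fin d → ℤ)) : Type := Matrix (Config Λ) (Config Λ) ℂ

/-- The distance `|i - j|` on `ℤ^d` (the `ℓ¹` distance). -/
def latticeDist {d : ℕ} (i j : Fin d → ℤ) : ℝ := ∑ k, |(i k : ℝ) - (j k : ℝ)|

/-- The Pauli matrix `σ^x` in the basis `|1⟩, |-1⟩`. -/
def pauliX : Matrix ℤˣ ℤˣ ℂ := Matrix.of fun s t => if s = t then 0 else 1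

/-- The operator `1 ⊗ ⋯ ⊗ A ⊗ ⋯ ⊗ 1` with the one-site operator `A` acting at the site `i`:
its matrix elements in the product basis are the products of the one-site matrix elements. -/
def siteOp {d : ℕ} {Λ : Finset (Fin d → ℤ)} (A : Matrix ℤˣ ℤˣ ℂ) (i : Λ) : Op Λ :=
  Matrix.of fun σ τ => ∏ j : Λ, (if j = i then A else 1) (σ j) (τ j)

/-- The operator `f(σ^z_1, …, σ^z_{|Λ|})`, acting by `|σ⟩ ↦ f(σ) |σ⟩`. -/
def spinObservable {d : ℕ} {Λ : Finset (Fin d → ℤ)} (f : Config Λ → ℝ) : Op Λ :=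
  Matrix.diagonal fun σ => (f σ : ℂ)

/-- The quantum Hamiltonian `H_cl - ∑_i λ_i σ^x_i`. -/
def hamiltonian {d : ℕ} {Λ : Finset (Fin d → ℤ)} (H : Config Λ → ℝ) (field : Λ → ℝ) : Op Λ :=
  spinObservable H - ∑ i : Λ, (field i : ℂ) • siteOp pauliX i

/-- The quantum average `Tr(F e^{-β𝓗}) / Tr(e^{-β𝓗})`. -/
def quantumAverage {d : ℕ} {Λ : Finset (Fin d → ℤ)} (β : ℝ) (𝓗 F : Op Λ) : ℂ :=
  (F * NormedSpace.exp (-(β : ℂ) • 𝓗)).trace / (NormedSpace.exp (-(β : ℂ) • 𝓗)).trace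

/-- The truncated correlation `⟨F; G⟩ = ⟨F G⟩ - ⟨F⟩⟨G⟩`. -/
def truncatedCorrelation {d : ℕ} {Λ : Finset (Fin d → ℤ)} (β : ℝ) (𝓗 F G : Op Λ) : ℂ :=
  quantumAverage β 𝓗 (F * G) - quantumAverage β 𝓗 F * quantumAverage β 𝓗 G

/-- The configuration `σ^i`: the spin at `i` is flipped. -/
def flipSpin {d : ℕ} {Λ : Finset (Fin d → ℤ)} (i : Λ) (σ : Config Λ) : Config Λ :=
  Function.update σ i (-σ i)

/-- `∇_i f(σ) = f(σ^i) - f(σ)`. -/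
def grad {d : ℕ} {Λ : Finset (Fin d → ℤ)} (i : Λ) (f : Config Λ → ℝ) : Config Λ → ℝ :=
  fun σ => f (flipSpin i σ) - f σ

/-- `|||f||| = ∑_i ‖∇_i f‖`, where `‖·‖` is the sup norm on the functions on the finite
set of configurations (Mathlib's norm on a finite product). -/
def tripleNorm {d : ℕ} {Λ : Finset (Fin d → ℤ)} (f : Config Λ → ℝ) : ℝ :=
  ∑ i : Λ, ‖grad i f‖

/-- `Λ_f`, the set of sites on which `f` depends. -/
def supportSites {d : ℕ} {Λ : Finset (Fin d → ℤ)} (f : Config Λ → ℝ) : Set Λ :=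
  {i | 0 < ‖grad i f‖}

/-- `dist(A, B) = min {|i - j| : i ∈ A, j ∈ B}`; it is `0` if `A` or `B` is empty. -/
def setDist {d : ℕ} {Λ : Finset (Fin d → ℤ)} (A B : Set Λ) : ℝ :=
  sInf {r : ℝ | ∃ i ∈ A, ∃ j ∈ B, r = latticeDist (i : Fin d → ℤ) (j : Fin d → ℤ)}

/-- Condition (BD): bounded differences of `H` and bounds on the transverse field. -/
def BoundedDifferences {d : ℕ} {Λ : Finset (Fin d → ℤ)} (H : Config Λ → ℝ) (field : Λ → ℝ)
    (C lam : ℝ) : Prop :=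
  (∀ i σ, |grad i H σ| ≤ C) ∧ ∀ i, 0 ≤ field i ∧ field i ≤ lam

/-- Condition (LOC): `∇_i H` depends only on the spins within distance `R` of `i`. -/
def Locality {d : ℕ} {Λ : Finset (Fin d → ℤ)} (H : Config Λ → ℝ) (R : ℝ) : Prop :=
  ∀ (i : Λ) (σ η : Config Λ),
    (∀ j : Λ, latticeDist (j : Fin d → ℤ) (i : Fin d → ℤ) ≤ R → σ j = η j) →
      grad i H σ = grad i H η

/-- `γ = e^{-2βC} - 5 max(1, βλ) (2R)^d (e^{3βC} - 1)`. -/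
def gammaConst (d : ℕ) (β C lam R : ℝ) : ℝ :=
  Real.exp (-2 * β * C) - 5 * max 1 (β * lam) * (2 * R) ^ d * (Real.exp (3 * β * C) - 1)

/-- `N = (2 / (1 - e^{-1/R}))^d`. -/
def prefactorConst (d : ℕ) (R : ℝ) : ℝ := (2 / (1 - Real.exp (-1 / R))) ^ d

/-- `δ = (1 / (2R)) min(1/2, γ / (10 max(1, λβ) e^{βC + 1}))`. -/
def decayRate (d : ℕ) (β C lam R : ℝ) : ℝ :=
  1 / (2 * R) *
    min (1 / 2) (gammaConst d β C lam R / (10 * max 1 (lam * β) * Real.exp (β * C + 1)))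

end TransverseField

end

/-! A product of many short-time transfer matrices with nonnegative entries approximates `e^{-β𝓗}`,
so its traces are sums over closed paths of configurations. Exchanging space and time turns this
into a classical Gibbs measure on `Λ` whose "spin" at a site is a whole periodic path. The
transverse field enters only the product reference weight; the sites interact only through the time
average of `βH`. Diagonal observables see the paths at time 0.

For such a measure Dobrushin's method works whatever the single-site space and reference weight.
Changing the path at `j` alters energy differences at `i` by at most `2βC`, and not at all when `|i
- j| > R`, so the conditional law at `i` moves by at most `e^{2βC} - 1` in `ℓ¹`, uniformly in the
number of time slices. Positivity of `γ` makes the total influence on a site at most `1/5`. This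
leaves room for the weights `ρ_j = e^{dist(Λ_f, j)/(4R)}`: the weighted influence contracts with
factor `1/2`, which gives a covariance bound with prefactor `2 ≤ N` and rate `1/(4R) ≥ δ`. In
dimension 0 there are no neighbours and the factor is 0.

The carriers are `SiteKernel.abs_weightedCov_le` (comparison), `sum_abs_gibbsKernel_sub_le` and
`abs_mixed_difference_pathEnergy_le` (influences), `card_punctured_ball_le` (number of neighbours)
and `tendsto_weightedCov_pathModel` (the limit). -/

namespace TransverseField

open Function Filter Topology

set_option linter.unusedSectionVars false

/-! ### Dobrushin's contraction for covariances on a finite product space -/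

section Dobrushin

variable {I S : Type*} [Fintype I] [DecidableEq I] [Fintype S]

/-- The oscillation of `F` in the coordinate `j`. -/
noncomputable def siteOsc (j : I) (F : (I → S) → ℝ) : ℝ :=
  ‖fun p : (I → S) × S => F (update p.1 j p.2) - F p.1‖

theorem siteOsc_nonneg (j : I) (F : (I → S) → ℝ) : 0 ≤ siteOsc j F := norm_nonneg _

theorem abs_update_sub_le_siteOsc (j : I) (F : (I → S) → ℝ) (ω : I → S) (s : S) :
    |F (update ω j s) - F ω| ≤ siteOsc j F :=
  norm_le_pi_norm (fun p : (I → S) × S => F (update p.1 j p.2) - F p.1) (ω, s)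

theorem siteOsc_le {j : I} {F : (I → S) → ℝ} {r : ℝ} (hr : 0 ≤ r)
    (h : ∀ ω s, |F (update ω j s) - F ω| ≤ r) : siteOsc j F ≤ r :=
  (pi_norm_le_iff_of_nonneg hr).2 fun p => h p.1 p.2

theorem abs_sub_le_sum_siteOsc (F : (I → S) → ℝ) (ω η : I → S) :
    |F ω - F η| ≤ ∑ i, siteOsc i F := by
  have key : ∀ s : Finset I, |F (s.piecewise ω η) - F η| ≤ ∑ i ∈ s, siteOsc i F := by
    intro s
    induction s using Finset.induction_on with
    | empty => simp
    | insert j s hj ih =>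
      rw [Finset.piecewise_insert, Finset.sum_insert hj]
      calc _ ≤ |F (update (s.piecewise ω η) j (ω j)) - F (s.piecewise ω η)| +
            |F (s.piecewise ω η) - F η| := abs_sub_le _ _ _
        _ ≤ _ := add_le_add (abs_update_sub_le_siteOsc _ _ _ _) ih
  simpa using key Finset.univ

/-- The covariance of `F` and `G` under the weights `w`. -/
def weightedCov (w F G : (I → S) → ℝ) : ℝ :=
  ∑ ω, w ω * (F ω * G ω) - (∑ ω, w ω * F ω) * ∑ ω, w ω * G ω

/-- Single-site conditional distributions of the weights `w`: `prob i ω s` is the conditional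
probability of the value `s` at the site `i`, given the values of `ω` at the other sites. -/
structure SiteKernel (w : (I → S) → ℝ) where
  prob : I → (I → S) → S → ℝ
  prob_nonneg : ∀ i ω s, 0 ≤ prob i ω s
  sum_prob : ∀ i ω, ∑ s, prob i ω s = 1
  prob_update : ∀ i ω s, prob i (update ω i s) = prob i ω
  reversible : ∀ i ω s t, w (update ω i s) * prob i ω t = w (update ω i t) * prob i ω s

namespace SiteKernel

variable {w : (I → S) → ℝ} (K : SiteKernel w)

/-- Resampling of the value at the site `i` from its conditional distribution. -/
def heatBath (i : I) (F : (I → S) → ℝ) (ω : I → S) : ℝ :=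
  ∑ s, K.prob i ω s * F (update ω i s)

theorem heatBath_update (i : I) (F : (I → S) → ℝ) (ω : I → S) (s : S) :
    K.heatBath i F (update ω i s) = K.heatBath i F ω := by
  simp [heatBath, K.prob_update]

theorem sum_mul_heatBath_mul (i : I) (F h : (I → S) → ℝ)
    (hh : ∀ ω s, h (update ω i s) = h ω) :
    ∑ ω, w ω * (K.heatBath i F ω * h ω) = ∑ ω, w ω * (F ω * h ω) := by
  -- Swapping the resampled value with the current value at `i` is an involution on pairs;
  -- reversibility says that the joint weight is invariant under it.
  have hinv : Involutive fun p : (I → S) × S => (update p.1 i p.2, p.1 i) := by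
    rintro ⟨ω, s⟩
    simp
  calc ∑ ω, w ω * (K.heatBath i F ω * h ω)
      = ∑ p : (I → S) × S, w p.1 * (K.prob i p.1 p.2 * F (update p.1 i p.2) * h p.1) := by
        rw [Fintype.sum_prod_type]
        simp [heatBath, Finset.sum_mul, Finset.mul_sum]
    _ = ∑ p : (I → S) × S, w (update p.1 i p.2) *
          (K.prob i p.1 (p.1 i) * F p.1 * h p.1) := by
        refine Fintype.sum_equiv hinv.toPerm _ _ ?_
        rintro ⟨ω, s⟩
        simp [K.prob_update, hh]
    _ = ∑ p : (I → S) × S, K.prob i p.1 p.2 * (w p.1 * (F p.1 * h p.1)) := by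
        refine Finset.sum_congr rfl fun p _ => ?_
        have := K.reversible i p.1 p.2 (p.1 i)
        rw [update_eq_self] at this
        linear_combination (F p.1 * h p.1) * this
    _ = ∑ ω, w ω * (F ω * h ω) := by
        rw [Fintype.sum_prod_type]
        simp [← Finset.sum_mul, K.sum_prob]

theorem sum_mul_heatBath (i : I) (F : (I → S) → ℝ) :
    ∑ ω, w ω * K.heatBath i F ω = ∑ ω, w ω * F ω := by
  simpa using K.sum_mul_heatBath_mul i F (fun _ => 1) (fun _ _ => rfl)

theorem abs_heatBath_sub_le (i : I) (F : (I → S) → ℝ) (ω : I → S) :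
    |K.heatBath i F ω - F ω| ≤ siteOsc i F := by
  have h1 : K.heatBath i F ω - F ω = ∑ s, K.prob i ω s * (F (update ω i s) - F ω) := by
    simp [heatBath, mul_sub, Finset.sum_sub_distrib, ← Finset.sum_mul, K.sum_prob]
  rw [h1]
  calc _ ≤ ∑ s, K.prob i ω s * siteOsc i F := by
        refine (Finset.abs_sum_le_sum_abs _ _).trans (Finset.sum_le_sum fun s _ => ?_)
        rw [abs_mul, abs_of_nonneg (K.prob_nonneg i ω s)]
        exact mul_le_mul_of_nonneg_left (abs_update_sub_le_siteOsc _ _ _ _)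
          (K.prob_nonneg i ω s)
    _ = siteOsc i F := by rw [← Finset.sum_mul, K.sum_prob, one_mul]

/-- Resampling at `i` is the conditional expectation given the other sites, so the loss is the mean
of the conditional covariance, `E[(F - PF)(G - PG)]`. -/
theorem abs_weightedCov_sub_heatBath_le (hw : ∀ ω, 0 ≤ w ω) (hw1 : ∑ ω, w ω = 1) (i : I)
    (F G : (I → S) → ℝ) :
    |weightedCov w F G - weightedCov w (K.heatBath i F) G| ≤ siteOsc i F * siteOsc i G := by
  have h1 : weightedCov w F G - weightedCov w (K.heatBath i F) G =
      ∑ ω, w ω * ((K.heatBath i F ω - F ω) * (K.heatBath i G ω - G ω)) := by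
    have e1 := K.sum_mul_heatBath_mul i F (K.heatBath i G) (K.heatBath_update i G)
    have e2 : ∑ ω, w ω * ((K.heatBath i F ω - F ω) * (K.heatBath i G ω - G ω)) =
        ∑ ω, w ω * (K.heatBath i F ω * K.heatBath i G ω) -
          ∑ ω, w ω * (F ω * K.heatBath i G ω) -
          ∑ ω, w ω * (K.heatBath i F ω * G ω) + ∑ ω, w ω * (F ω * G ω) := by
      simp only [← Finset.sum_sub_distrib, ← Finset.sum_add_distrib]
      exact Finset.sum_congr rfl fun ω _ => by ring
    rw [e2, e1, weightedCov, weightedCov, K.sum_mul_heatBath]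
    ring
  rw [h1]
  calc _ ≤ ∑ ω, w ω * (siteOsc i F * siteOsc i G) := by
        refine (Finset.abs_sum_le_sum_abs _ _).trans (Finset.sum_le_sum fun ω _ => ?_)
        rw [abs_mul, abs_mul, abs_of_nonneg (hw ω)]
        exact mul_le_mul_of_nonneg_left (mul_le_mul (K.abs_heatBath_sub_le _ _ _)
          (K.abs_heatBath_sub_le _ _ _) (abs_nonneg _) (siteOsc_nonneg _ _)) (hw ω)
    _ = _ := by rw [← Finset.sum_mul, hw1, one_mul]

theorem siteOsc_heatBath_self (i : I) (F : (I → S) → ℝ) : siteOsc i (K.heatBath i F) = 0 :=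
  le_antisymm (siteOsc_le le_rfl fun ω s => by simp [heatBath_update]) (siteOsc_nonneg _ _)

/-- A change at `j` acts twice: on `F` under a fixed law at `i`, and on that law. In the second
effect `F` may be centred at `F ω`, since both laws have mass one, and then only the oscillation at
`i` remains. -/
theorem siteOsc_heatBath_le {i j : I} (hij : j ≠ i) {c : ℝ} (hc : 0 ≤ c)
    (h : ∀ ω s, ∑ t, |K.prob i (update ω j s) t - K.prob i ω t| ≤ c) (F : (I → S) → ℝ) :
    siteOsc j (K.heatBath i F) ≤ siteOsc j F + c * siteOsc i F := by
  refine siteOsc_le (add_nonneg (siteOsc_nonneg _ _) (mul_nonneg hc (siteOsc_nonneg _ _))) ?_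
  intro ω u
  have e : K.heatBath i F (update ω j u) - K.heatBath i F ω =
      ∑ t, K.prob i (update ω j u) t * (F (update (update ω i t) j u) - F (update ω i t)) +
        ∑ t, (K.prob i (update ω j u) t - K.prob i ω t) * (F (update ω i t) - F ω) := by
    have e1 : ∑ t, (K.prob i (update ω j u) t - K.prob i ω t) * F ω = 0 := by
      rw [← Finset.sum_mul, Finset.sum_sub_distrib, K.sum_prob, K.sum_prob]
      ring
    simp only [mul_sub, Finset.sum_sub_distrib, e1, sub_zero]
    simp only [heatBath, sub_mul, Finset.sum_sub_distrib, update_comm hij]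
    ring
  rw [e]
  refine (abs_add_le _ _).trans (add_le_add ?_ ?_)
  · calc _ ≤ ∑ t, K.prob i (update ω j u) t * siteOsc j F := by
          refine (Finset.abs_sum_le_sum_abs _ _).trans (Finset.sum_le_sum fun t _ => ?_)
          rw [abs_mul, abs_of_nonneg (K.prob_nonneg _ _ _)]
          exact mul_le_mul_of_nonneg_left (abs_update_sub_le_siteOsc _ _ _ _)
            (K.prob_nonneg _ _ _)
      _ = _ := by rw [← Finset.sum_mul, K.sum_prob, one_mul]
  · calc _ ≤ ∑ t, |K.prob i (update ω j u) t - K.prob i ω t| * siteOsc i F := by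
          refine (Finset.abs_sum_le_sum_abs _ _).trans (Finset.sum_le_sum fun t _ => ?_)
          rw [abs_mul]
          exact mul_le_mul_of_nonneg_left (abs_update_sub_le_siteOsc _ _ _ _) (abs_nonneg _)
      _ ≤ _ := by
          rw [← Finset.sum_mul]
          exact mul_le_mul_of_nonneg_right (h ω u) (siteOsc_nonneg _ _)

/-- Resampling erases the oscillation at `i` and spreads it over the other sites, where its weight
is at most a fraction `a` of what was erased. -/
theorem sum_siteOsc_heatBath_le {c : I → I → ℝ} {ρ : I → ℝ} {a : ℝ}
    (hc : ∀ i j, 0 ≤ c i j) (hρ : ∀ i, 0 ≤ ρ i)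
    (h : ∀ i j, j ≠ i → ∀ ω s, ∑ t, |K.prob i (update ω j s) t - K.prob i ω t| ≤ c i j)
    (hcρ : ∀ i, ∑ j, ρ j * c i j ≤ a * ρ i) (i : I) (F : (I → S) → ℝ) :
    ∑ j, ρ j * siteOsc j (K.heatBath i F) ≤
      ∑ j, ρ j * siteOsc j F - (1 - a) * (ρ i * siteOsc i F) := by
  have h1 : ∀ j, ρ j * siteOsc j (K.heatBath i F) ≤
      ρ j * siteOsc j F + ρ j * c i j * siteOsc i F - if j = i then ρ i * siteOsc i F else 0 := by
    intro j
    by_cases hj : j = i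
    · subst hj
      rw [siteOsc_heatBath_self, if_pos rfl]
      have := mul_nonneg (mul_nonneg (hρ j) (hc j j)) (siteOsc_nonneg j F)
      linarith
    · rw [if_neg hj, sub_zero, mul_assoc, ← mul_add]
      exact mul_le_mul_of_nonneg_left (K.siteOsc_heatBath_le hj (hc i j) (h i j hj) F) (hρ j)
  calc _ ≤ _ := Finset.sum_le_sum fun j _ => h1 j
    _ = ∑ j, ρ j * siteOsc j F + (∑ j, ρ j * c i j) * siteOsc i F - ρ i * siteOsc i F := by
        simp [Finset.sum_sub_distrib, Finset.sum_add_distrib, Finset.sum_mul]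
    _ ≤ _ := by
        have := mul_le_mul_of_nonneg_right (hcρ i) (siteOsc_nonneg i F)
        linarith

end SiteKernel

/-- A crude bound without decay, needed to start the iteration in the comparison theorem. -/
theorem abs_weightedCov_le_norm_mul {w : (I → S) → ℝ} (hw : ∀ ω, 0 ≤ w ω)
    (hw1 : ∑ ω, w ω = 1) (F G : (I → S) → ℝ) :
    |weightedCov w F G| ≤ ‖G‖ * ∑ i, siteOsc i F := by
  have hF : ∀ ω, |F ω - ∑ η, w η * F η| ≤ ∑ i, siteOsc i F := by
    intro ω
    have e : F ω - ∑ η, w η * F η = ∑ η, w η * (F ω - F η) := by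
      simp [mul_sub, Finset.sum_sub_distrib, ← Finset.sum_mul, hw1]
    rw [e]
    calc _ ≤ ∑ η, w η * ∑ i, siteOsc i F := by
          refine (Finset.abs_sum_le_sum_abs _ _).trans (Finset.sum_le_sum fun η _ => ?_)
          rw [abs_mul, abs_of_nonneg (hw η)]
          exact mul_le_mul_of_nonneg_left (abs_sub_le_sum_siteOsc _ _ _) (hw η)
      _ = _ := by rw [← Finset.sum_mul, hw1, one_mul]
  have e : weightedCov w F G = ∑ ω, w ω * ((F ω - ∑ η, w η * F η) * G ω) := by
    simp only [weightedCov, sub_mul, mul_sub, Finset.sum_sub_distrib, Finset.mul_sum]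
    congr 1
    exact Finset.sum_congr rfl fun ω _ => by ring
  rw [e]
  calc _ ≤ ∑ ω, w ω * (‖G‖ * ∑ i, siteOsc i F) := by
        refine (Finset.abs_sum_le_sum_abs _ _).trans (Finset.sum_le_sum fun ω _ => ?_)
        rw [abs_mul, abs_mul, abs_of_nonneg (hw ω), mul_comm ‖G‖]
        exact mul_le_mul_of_nonneg_left (mul_le_mul (hF ω) (norm_le_pi_norm G ω) (abs_nonneg _)
          (Finset.sum_nonneg fun i _ => siteOsc_nonneg _ _)) (hw ω)
    _ = _ := by rw [← Finset.sum_mul, hw1, one_mul]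

/-- Dobrushin's comparison: if the influences `c i j` of the site `j` on the conditional
distribution at `i` contract the weights `ρ`, covariances are controlled by the weighted
oscillations. -/
theorem SiteKernel.abs_weightedCov_le {w : (I → S) → ℝ} (K : SiteKernel w)
    (hw : ∀ ω, 0 ≤ w ω) (hw1 : ∑ ω, w ω = 1) {c : I → I → ℝ} {ρ : I → ℝ} {a B : ℝ}
    (hc : ∀ i j, 0 ≤ c i j) (hρ : ∀ i, 1 ≤ ρ i) (ha0 : 0 ≤ a) (ha : a < 1) (hB : 0 ≤ B)
    (h : ∀ i j, j ≠ i → ∀ ω s, ∑ t, |K.prob i (update ω j s) t - K.prob i ω t| ≤ c i j)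
    (hcρ : ∀ i, ∑ j, ρ j * c i j ≤ a * ρ i) (F G : (I → S) → ℝ)
    (hG : ∀ i, siteOsc i G ≤ B * ρ i) :
    |weightedCov w F G| ≤ B / (1 - a) * ∑ i, ρ i * siteOsc i F := by
  have hρ0 : ∀ i, 0 ≤ ρ i := fun i => zero_le_one.trans (hρ i)
  have hsum0 : ∀ F : (I → S) → ℝ, 0 ≤ ∑ i, ρ i * siteOsc i F := fun F =>
    Finset.sum_nonneg fun i _ => mul_nonneg (hρ0 i) (siteOsc_nonneg _ _)
  have hprior : ∀ F : (I → S) → ℝ, |weightedCov w F G| ≤ ‖G‖ * ∑ i, ρ i * siteOsc i F := by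
    intro F
    refine (abs_weightedCov_le_norm_mul hw hw1 F G).trans ?_
    refine mul_le_mul_of_nonneg_left (Finset.sum_le_sum fun i _ => ?_) (norm_nonneg _)
    exact le_mul_of_one_le_left (siteOsc_nonneg _ _) (hρ i)
  rcases isEmpty_or_nonempty I with hI | hI
  · have := hprior F
    simpa using this
  have hm : (1 : ℝ) ≤ Fintype.card I := by exact_mod_cast Fintype.card_pos
  have hm0 : (0 : ℝ) < Fintype.card I := by linarith
  have ha1 : 0 < 1 - a := by linarith
  set m : ℝ := (Fintype.card I : ℝ) with hmdef
  set L := B / (1 - a) with hL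
  have hL0 : 0 ≤ L := div_nonneg hB ha1.le
  have hLa : L * (1 - a) = B := by rw [hL]; field_simp
  set q := 1 - (1 - a) / m with hq
  have hq0 : 0 ≤ q := by
    rw [hq, sub_nonneg, div_le_one hm0]
    linarith
  have hq1 : q < 1 := by
    have := div_pos ha1 hm0
    linarith
  have hqm : q * m = m - (1 - a) := by
    rw [hq]
    field_simp
  -- Apply the current bound to `F` resampled at `i`, pay `B ρ_i` times the oscillation at `i`, and
  -- average over all `i`. The constant `L = B / (1 - a)` is the fixed point of this operation, and
  -- the excess `A` shrinks by `q = 1 - (1 - a) / m`.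
  have step : ∀ A, 0 ≤ A →
      (∀ F : (I → S) → ℝ, |weightedCov w F G| ≤ (L + A) * ∑ i, ρ i * siteOsc i F) →
      ∀ F : (I → S) → ℝ, |weightedCov w F G| ≤ (L + A * q) * ∑ i, ρ i * siteOsc i F := by
    intro A hA hAF F
    have hi : ∀ i, |weightedCov w F G| ≤
        (L + A) * (∑ j, ρ j * siteOsc j F - (1 - a) * (ρ i * siteOsc i F)) +
          B * (ρ i * siteOsc i F) := by
      intro i
      have h1 := K.abs_weightedCov_sub_heatBath_le hw hw1 i F G
      have h2 := hAF (K.heatBath i F)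
      have h3 := mul_le_mul_of_nonneg_left
        (K.sum_siteOsc_heatBath_le hc hρ0 h hcρ i F) (add_nonneg hL0 hA)
      have h4 := mul_le_mul_of_nonneg_left (hG i) (siteOsc_nonneg i F)
      have h5 := abs_sub_abs_le_abs_sub (weightedCov w F G) (weightedCov w (K.heatBath i F) G)
      linarith
    have hs := Finset.sum_le_sum fun i (_ : i ∈ Finset.univ) => hi i
    simp only [Finset.sum_add_distrib, ← Finset.mul_sum, Finset.sum_sub_distrib,
      Finset.sum_const, Finset.card_univ, nsmul_eq_mul, ← hmdef] at hs
    refine le_of_mul_le_mul_left (hs.trans (le_of_eq ?_)) hm0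
    rw [← hLa]
    linear_combination (- A * ∑ i, ρ i * siteOsc i F) * hqm
  have hn : ∀ n : ℕ, ∀ F : (I → S) → ℝ,
      |weightedCov w F G| ≤ (L + ‖G‖ * q ^ n) * ∑ i, ρ i * siteOsc i F := by
    intro n
    induction n with
    | zero =>
      intro F
      refine (hprior F).trans (mul_le_mul_of_nonneg_right ?_ (hsum0 F))
      simpa using hL0
    | succ n ih =>
      have := step _ (mul_nonneg (norm_nonneg G) (pow_nonneg hq0 n)) ih
      simpa [pow_succ, mul_assoc] using this
  have hlim : Tendsto (fun n : ℕ => (L + ‖G‖ * q ^ n) * ∑ i, ρ i * siteOsc i F) atTop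
      (𝓝 ((L + ‖G‖ * 0) * ∑ i, ρ i * siteOsc i F)) :=
    ((tendsto_pow_atTop_nhds_zero_of_lt_one hq0 hq1).const_mul _ |>.const_add _).mul_const _
  rw [mul_zero, add_zero] at hlim
  exact ge_of_tendsto' hlim fun n => hn n F

end Dobrushin

/-! ### Conditional laws of Gibbs weights and their dependence on the boundary -/

section Gibbs

variable {I S : Type*} [Fintype I] [DecidableEq I] [Fintype S]

/-- The unnormalized weight `e^{-E(ω)} ∏ i, p i (ω i)`. -/
noncomputable def gibbsWeight (p : I → S → ℝ) (E : (I → S) → ℝ) (ω : I → S) : ℝ :=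
  Real.exp (-E ω) * ∏ i, p i (ω i)

/-- The normalized weights. -/
noncomputable def gibbsProb (p : I → S → ℝ) (E : (I → S) → ℝ) (ω : I → S) : ℝ :=
  gibbsWeight p E ω / ∑ η, gibbsWeight p E η

/-- The normalization of the conditional distribution at the site `i`. -/
noncomputable def localPartition (p : I → S → ℝ) (E : (I → S) → ℝ) (i : I) (ω : I → S) : ℝ :=
  ∑ s, p i s * Real.exp (-E (update ω i s))

variable {p : I → S → ℝ} {E : (I → S) → ℝ}

theorem gibbsWeight_nonneg (hp : ∀ i s, 0 ≤ p i s) (ω : I → S) : 0 ≤ gibbsWeight p E ω :=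
  mul_nonneg (Real.exp_pos _).le (Finset.prod_nonneg fun i _ => hp i _)

theorem gibbsProb_nonneg (hp : ∀ i s, 0 ≤ p i s) (ω : I → S) : 0 ≤ gibbsProb p E ω :=
  div_nonneg (gibbsWeight_nonneg hp ω) (Finset.sum_nonneg fun η _ => gibbsWeight_nonneg hp η)

theorem localPartition_pos (hp : ∀ i s, 0 ≤ p i s) (hp' : ∀ i, ∃ s, 0 < p i s) (i : I)
    (ω : I → S) : 0 < localPartition p E i ω := by
  obtain ⟨s, hs⟩ := hp' i
  exact Finset.sum_pos' (fun s _ => mul_nonneg (hp i s) (Real.exp_pos _).le)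
    ⟨s, Finset.mem_univ s, mul_pos hs (Real.exp_pos _)⟩

theorem sum_gibbsWeight_pos (hp : ∀ i s, 0 ≤ p i s) (hp' : ∀ i, ∃ s, 0 < p i s) :
    0 < ∑ ω, gibbsWeight p E ω := by
  choose s hs using hp'
  exact Finset.sum_pos' (fun ω _ => gibbsWeight_nonneg hp ω)
    ⟨s, Finset.mem_univ s, mul_pos (Real.exp_pos _) (Finset.prod_pos fun i _ => hs i)⟩

theorem sum_gibbsProb (hp : ∀ i s, 0 ≤ p i s) (hp' : ∀ i, ∃ s, 0 < p i s) :
    ∑ ω, gibbsProb p E ω = 1 := by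
  simp only [gibbsProb]
  rw [← Finset.sum_div, div_self (sum_gibbsWeight_pos hp hp').ne']

theorem weightedCov_gibbsProb (F G : (I → S) → ℝ) :
    weightedCov (gibbsProb p E) F G =
      (∑ ω, gibbsWeight p E ω * (F ω * G ω)) / (∑ ω, gibbsWeight p E ω) -
        (∑ ω, gibbsWeight p E ω * F ω) / (∑ ω, gibbsWeight p E ω) *
          ((∑ ω, gibbsWeight p E ω * G ω) / (∑ ω, gibbsWeight p E ω)) := by
  simp only [weightedCov, gibbsProb, Finset.sum_div, div_mul_eq_mul_div]

/-- The conditional distributions of the Gibbs weights. -/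
noncomputable def gibbsKernel (hp : ∀ i s, 0 ≤ p i s) (hp' : ∀ i, ∃ s, 0 < p i s) :
    SiteKernel (gibbsProb p E) where
  prob i ω s := p i s * Real.exp (-E (update ω i s)) / localPartition p E i ω
  prob_nonneg i ω s := div_nonneg (mul_nonneg (hp i s) (Real.exp_pos _).le)
    (localPartition_pos hp hp' i ω).le
  sum_prob i ω := by
    rw [← Finset.sum_div]
    exact div_self (localPartition_pos hp hp' i ω).ne'
  prob_update i ω s := by
    funext t
    simp [localPartition]
  reversible i ω s t := by
    have h : ∀ s, ∏ j, p j (update ω i s j) = p i s * ∏ j ∈ Finset.univ.erase i, p j (ω j) := by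
      intro s
      rw [← Finset.mul_prod_erase _ _ (Finset.mem_univ i), update_self]
      congr 1
      exact Finset.prod_congr rfl fun j hj => by rw [update_of_ne (Finset.ne_of_mem_erase hj)]
    simp only [gibbsProb, gibbsWeight, h]
    ring

/-- After clearing the two normalizations the inequality holds term by term in the summation
variable `t`; the reference weights `p i s * p i t` are common to both sides. -/
theorem gibbsKernel_prob_le (hp : ∀ i s, 0 ≤ p i s) (hp' : ∀ i, ∃ s, 0 < p i s) {i : I} {b : ℝ}
    {ω η : I → S} (h : ∀ s t, (E (update η i s) - E (update η i t)) -
      (E (update ω i s) - E (update ω i t)) ≤ b) (s : S) :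
    (gibbsKernel (E := E) hp hp').prob i ω s ≤
      Real.exp b * (gibbsKernel (E := E) hp hp').prob i η s := by
  have hω := localPartition_pos (E := E) hp hp' i ω
  have hη := localPartition_pos (E := E) hp hp' i η
  simp only [gibbsKernel]
  rw [mul_div_assoc', div_le_div_iff₀ hω hη]
  simp only [localPartition, Finset.mul_sum]
  refine Finset.sum_le_sum fun t _ => ?_
  have h1 : Real.exp (-E (update ω i s)) * Real.exp (-E (update η i t)) ≤
      Real.exp b * Real.exp (-E (update η i s)) * Real.exp (-E (update ω i t)) := by
    rw [← Real.exp_add, ← Real.exp_add, ← Real.exp_add, Real.exp_le_exp]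
    linarith [h s t]
  nlinarith [mul_le_mul_of_nonneg_left h1 (mul_nonneg (hp i s) (hp i t))]

theorem sum_abs_gibbsKernel_sub_le (hp : ∀ i s, 0 ≤ p i s) (hp' : ∀ i, ∃ s, 0 < p i s) {i : I}
    {b : ℝ} {ω η : I → S} (hb : 0 ≤ b) (h : ∀ s t, |(E (update η i s) - E (update η i t)) -
      (E (update ω i s) - E (update ω i t))| ≤ b) :
    ∑ s, |(gibbsKernel (E := E) hp hp').prob i η s - (gibbsKernel (E := E) hp hp').prob i ω s| ≤
      Real.exp b - 1 := by
  set K := gibbsKernel (E := E) hp hp'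
  calc _ ≤ ∑ s, (Real.exp b - 1) * K.prob i ω s := by
        refine Finset.sum_le_sum fun s _ => ?_
        have h1 : K.prob i ω s ≤ Real.exp b * K.prob i η s :=
          gibbsKernel_prob_le hp hp' (fun s t => (le_abs_self _).trans (h s t)) s
        have h2 : K.prob i η s ≤ Real.exp b * K.prob i ω s :=
          gibbsKernel_prob_le hp hp' (fun s t => (le_abs_self _).trans
            (by rw [abs_sub_comm]; exact h s t)) s
        have hb1 : 1 ≤ Real.exp b := Real.one_le_exp hb
        have h3 := K.prob_nonneg i ω s
        rw [abs_le]
        constructor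
        -- The lower side uses the reversed comparison, which gives a drop of at most `(e^b - 1)
        -- K(η)`. If there is a drop at all, `K(η) ≤ K(ω)`.
        · by_contra hlt
          push Not at hlt
          have h4 : K.prob i η s ≤ K.prob i ω s := by nlinarith
          nlinarith
        · linarith
    _ = _ := by rw [← Finset.mul_sum, K.sum_prob, mul_one]

end Gibbs

/-! ### Distances to a set and counting of neighbours in `ℤ^d` -/

section Lattice

variable {d : ℕ}

theorem latticeDist_nonneg (i j : Fin d → ℤ) : 0 ≤ latticeDist i j :=
  Finset.sum_nonneg fun _ _ => abs_nonneg _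

theorem latticeDist_self (i : Fin d → ℤ) : latticeDist i i = 0 := by simp [latticeDist]

theorem latticeDist_triangle (i j k : Fin d → ℤ) :
    latticeDist i k ≤ latticeDist i j + latticeDist j k := by
  simp only [latticeDist, ← Finset.sum_add_distrib]
  exact Finset.sum_le_sum fun _ _ => abs_sub_le _ _ _

theorem setDist_nonneg {Λ : Finset (Fin d → ℤ)} (A B : Set Λ) : 0 ≤ setDist A B :=
  Real.sInf_nonneg (by rintro _ ⟨i, -, j, -, rfl⟩; exact latticeDist_nonneg _ _)

theorem setDist_le {Λ : Finset (Fin d → ℤ)} {A B : Set Λ} {i j : Λ} (hi : i ∈ A) (hj : j ∈ B) :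
    setDist A B ≤ latticeDist (i : Fin d → ℤ) j :=
  csInf_le ⟨0, by rintro _ ⟨i, -, j, -, rfl⟩; exact latticeDist_nonneg _ _⟩ ⟨i, hi, j, hj, rfl⟩

theorem setDist_le_singleton {Λ : Finset (Fin d → ℤ)} {A B : Set Λ} {j : Λ} (hj : j ∈ B) :
    setDist A B ≤ setDist A {j} := by
  rcases A.eq_empty_or_nonempty with rfl | ⟨i, hi⟩
  · simp [setDist]
  · refine le_csInf ⟨_, i, hi, j, rfl, rfl⟩ ?_
    rintro _ ⟨k, hk, _, rfl, rfl⟩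
    exact setDist_le hk hj

/-- The Lipschitz property that bounds the ratio of the exponential weights at neighbouring sites.
For empty `A` all distances are 0 by convention. -/
theorem setDist_singleton_le_add {Λ : Finset (Fin d → ℤ)} (A : Set Λ) (j k : Λ) :
    setDist A {k} ≤ setDist A {j} + latticeDist (j : Fin d → ℤ) k := by
  rcases A.eq_empty_or_nonempty with rfl | ⟨i, hi⟩
  · simpa [setDist] using latticeDist_nonneg _ _
  · rw [← sub_le_iff_le_add]
    refine le_csInf ⟨_, i, hi, j, rfl, rfl⟩ ?_
    rintro _ ⟨l, hl, j', hj', rfl⟩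
    obtain rfl : j' = j := hj'
    have := setDist_le hl (Set.mem_singleton k)
    have := latticeDist_triangle (l : Fin d → ℤ) j' k
    linarith

theorem setDist_singleton_of_mem {Λ : Finset (Fin d → ℤ)} {A : Set Λ} {j : Λ} (hj : j ∈ A) :
    setDist A {j} = 0 :=
  le_antisymm ((setDist_le hj (Set.mem_singleton j)).trans_eq (latticeDist_self _)) (setDist_nonneg _ _)

/-- The punctured `ℓ¹` ball of radius `r` in `ℤ^d` has at most `(2r)^d` points. -/
theorem card_punctured_ball_le {r : ℕ} (s : Finset (Fin d → ℤ)) (h0 : (0 : Fin d → ℤ) ∉ s)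
    (hs : ∀ x ∈ s, ∑ k, |x k| ≤ (r : ℤ)) : s.card ≤ (2 * r) ^ d := by
  have hcoord : ∀ x ∈ s, ∀ k, |x k| ≤ (r : ℤ) := fun x hx k =>
    (Finset.single_le_sum (f := fun k => |x k|) (fun _ _ => abs_nonneg _)
      (Finset.mem_univ k)).trans (hs x hx)
  have hpair : ∀ x ∈ s, ∀ k l, k ≠ l → |x k| + |x l| ≤ (r : ℤ) := fun x hx k l hkl => by
    refine le_trans ?_ (hs x hx)
    rw [← Finset.sum_pair (f := fun k => |x k|) hkl]
    exact Finset.sum_le_sum_of_subset_of_nonneg (Finset.subset_univ _)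
      fun _ _ _ => abs_nonneg _
  rcases Nat.eq_zero_or_pos r with rfl | hr
  · have : s = ∅ := by
      refine Finset.eq_empty_of_forall_notMem fun x hx => h0 ?_
      have : x = 0 := funext fun k => by simpa using hcoord x hx k
      exact this ▸ hx
    simp [this]
  rcases d with _ | d
  · have : s = ∅ := Finset.eq_empty_of_forall_notMem fun x hx => h0 (Subsingleton.elim x 0 ▸ hx)
    simp [this]
  -- The half-open cube `(-r, r]^(d+1)` has exactly the desired cardinality. The ball leaves it only
  -- at the points `-r e_k`. They are paid for by equally many cube points outside the punctured
  -- ball: the origin, and `r e_0 + r e_k` for `k ≠ 0`, of norm `2r > r`.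
  set cube : Finset (Fin (d + 1) → ℤ) :=
    Fintype.piFinset fun _ => Finset.Ioc (-(r : ℤ)) r with hcube
  have hcard : cube.card = (2 * r) ^ (d + 1) := by
    rw [hcube, Fintype.card_piFinset]
    simp only [Int.card_Ioc, Finset.prod_const, Finset.card_univ, Fintype.card_fin]
    congr 1
    omega
  -- the points of the ball outside the cube
  set A : Finset (Fin (d + 1) → ℤ) := Finset.univ.image fun k => Pi.single k (-(r : ℤ)) with hA
  -- as many points of the cube outside the punctured ball
  let y : Fin (d + 1) → Fin (d + 1) → ℤ := fun k =>
    if k = 0 then 0 else update (Pi.single k (r : ℤ)) 0 (r : ℤ)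
  have hyinj : Injective y := by
    have hne : ∀ k, k ≠ 0 → y k k = r ∧ y k 0 = r ∧ ∀ l, l ≠ 0 → l ≠ k → y k l = 0 := by
      intro k hk
      simp only [y, if_neg hk]
      exact ⟨by simp [hk], by simp, fun l hl hlk => by simp [hl, hlk]⟩
    have hy0 : y 0 = 0 := by simp [y]
    have hr' : (r : ℤ) ≠ 0 := by omega
    intro k l hkl
    by_cases hk : k = 0 <;> by_cases hl : l = 0
    · rw [hk, hl]
    · have := (hne l hl).2.1
      rw [← hkl, hk, hy0] at this
      exact absurd this.symm hr'
    · have := (hne k hk).2.1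
      rw [hkl, hl, hy0] at this
      exact absurd this.symm hr'
    · by_contra hne'
      have h1 := (hne k hk).1
      rw [hkl, (hne l hl).2.2 k hk hne'] at h1
      exact hr' h1.symm
  set Y := Finset.univ.image y with hY
  have hYcard : Y.card = d + 1 := by
    rw [hY, Finset.card_image_of_injective _ hyinj, Finset.card_univ, Fintype.card_fin]
  have hAcard : A.card ≤ d + 1 := by
    simpa using Finset.card_image_le (s := (Finset.univ : Finset (Fin (d + 1))))
      (f := fun k => (Pi.single k (-(r : ℤ)) : Fin (d + 1) → ℤ))
  have hYcube : Y ⊆ cube := by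
    intro x hx
    obtain ⟨k, -, rfl⟩ := Finset.mem_image.1 hx
    rw [hcube, Fintype.mem_piFinset]
    intro l
    have : y k l = 0 ∨ y k l = r := by
      simp only [y]
      split_ifs with hk
      · exact Or.inl rfl
      · by_cases hl : l = 0
        · subst hl; simp
        · by_cases hlk : l = k
          · subst hlk; simp [hl]
          · simp [hl, hlk]
    rw [Finset.mem_Ioc]
    omega
  have hsub : s ⊆ A ∪ (cube \ Y) := by
    intro x hx
    rw [Finset.mem_union, Finset.mem_sdiff]
    by_cases hxk : ∃ k, x k = -(r : ℤ)
    · left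
      obtain ⟨k, hk⟩ := hxk
      refine Finset.mem_image.2 ⟨k, Finset.mem_univ _, funext fun l => ?_⟩
      by_cases hl : l = k
      · subst hl; simp [hk]
      · have := hpair x hx k l (Ne.symm hl)
        rw [hk, abs_neg, Nat.abs_cast] at this
        have h2 : |x l| = 0 := le_antisymm (by linarith) (abs_nonneg _)
        simp [hl, abs_eq_zero.1 h2]
    · right
      push Not at hxk
      constructor
      · rw [hcube, Fintype.mem_piFinset]
        intro k
        have h1 := abs_le.1 (hcoord x hx k)
        have h2 := hxk k
        rw [Finset.mem_Ioc]
        omega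
      · intro hxY
        obtain ⟨k, -, rfl⟩ := Finset.mem_image.1 hxY
        by_cases hk : k = 0
        · apply h0
          simpa [y, hk] using hx
        · have := hpair _ hx k 0 hk
          simp [y, hk] at this
          omega
  calc s.card ≤ (A ∪ (cube \ Y)).card := Finset.card_le_card hsub
    _ ≤ A.card + (cube \ Y).card := Finset.card_union_le _ _
    _ = A.card + (cube.card - Y.card) := by rw [Finset.card_sdiff_of_subset hYcube]
    _ ≤ (2 * r) ^ (d + 1) := by
        have := Finset.card_le_card hYcube
        omega

theorem card_neighbours_le {R : ℝ} (hR : 0 < R) (Λ : Finset (Fin d → ℤ)) (i : Λ) :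
    ((Finset.univ.filter fun j : Λ => j ≠ i ∧
      latticeDist (j : Fin d → ℤ) i ≤ R).card : ℝ) ≤ (2 * R) ^ d := by
  set s := Finset.univ.filter fun j : Λ => j ≠ i ∧ latticeDist (j : Fin d → ℤ) i ≤ R
  have hinj : Injective fun j : Λ => (j : Fin d → ℤ) - (i : Fin d → ℤ) := fun j k h =>
    Subtype.ext (sub_left_injective h)
  -- Lattice distances are integers, so the radius may be rounded down to `⌊R⌋₊`.
  have h := card_punctured_ball_le (r := ⌊R⌋₊)
    (s.image fun j : Λ => (j : Fin d → ℤ) - (i : Fin d → ℤ)) ?_ ?_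
  · rw [Finset.card_image_of_injective _ hinj] at h
    calc (s.card : ℝ) ≤ ((2 * ⌊R⌋₊) ^ d : ℕ) := by exact_mod_cast h
      _ = (2 * (⌊R⌋₊ : ℝ)) ^ d := by push_cast; rfl
      _ ≤ (2 * R) ^ d := by
        gcongr
        exact Nat.floor_le hR.le
  · intro h0
    obtain ⟨j, hj, hji⟩ := Finset.mem_image.1 h0
    exact (Finset.mem_filter.1 hj).2.1 (Subtype.ext (sub_eq_zero.1 hji))
  · intro x hx
    obtain ⟨j, hj, rfl⟩ := Finset.mem_image.1 hx
    have h1 := (Finset.mem_filter.1 hj).2.2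
    rw [Int.natCast_floor_eq_floor hR.le, Int.le_floor]
    simpa [latticeDist] using h1

end Lattice

/-! ### Powers of near-identity elements converge to the exponential -/

section ExponentialLimit

variable {𝔸 : Type*} [NormedRing 𝔸]

theorem norm_pow_sub_pow_le [NormOneClass 𝔸] {x y : 𝔸} {M : ℝ} (hM : 1 ≤ M) (hx : ‖x‖ ≤ M)
    (hy : ‖y‖ ≤ M) (n : ℕ) : ‖x ^ n - y ^ n‖ ≤ n * M ^ n * ‖x - y‖ := by
  have hM0 : 0 ≤ M := zero_le_one.trans hM
  induction n with
  | zero => simp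
  | succ n ih =>
    have e : x ^ (n + 1) - y ^ (n + 1) = x ^ n * (x - y) + (x ^ n - y ^ n) * y := by
      rw [pow_succ, pow_succ]
      noncomm_ring
    have h1 : ‖x ^ n * (x - y)‖ ≤ M ^ (n + 1) * ‖x - y‖ := by
      refine (norm_mul_le _ _).trans (mul_le_mul_of_nonneg_right ?_ (norm_nonneg _))
      exact ((norm_pow_le x n).trans (pow_le_pow_left₀ (norm_nonneg _) hx n)).trans
        (pow_le_pow_right₀ hM n.le_succ)
    have h2 : ‖(x ^ n - y ^ n) * y‖ ≤ n * M ^ n * ‖x - y‖ * M :=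
      (norm_mul_le _ _).trans (mul_le_mul ih hy (norm_nonneg _) (by positivity))
    rw [e]
    refine (norm_add_le _ _).trans ((add_le_add h1 h2).trans (le_of_eq ?_))
    push_cast
    ring

/-- Both bases have norm at most `1 + b / (n + 1)`, so their powers stay below `e^b`. Telescoping
then bounds the difference of powers by `e^b (n + 1) ‖X n - Y n‖`, which vanishes because the two
limits agree. -/
theorem tendsto_pow_sub_pow_zero [NormOneClass 𝔸] [NormedSpace ℝ 𝔸] {X Y : ℕ → 𝔸} {A : 𝔸}
    (hX : Tendsto (fun n : ℕ => ((n : ℝ) + 1) • (X n - 1)) atTop (𝓝 A))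
    (hY : Tendsto (fun n : ℕ => ((n : ℝ) + 1) • (Y n - 1)) atTop (𝓝 A)) :
    Tendsto (fun n : ℕ => X n ^ (n + 1) - Y n ^ (n + 1)) atTop (𝓝 0) := by
  set b := ‖A‖ + 1
  have hb : 0 ≤ b := by positivity
  have bound : ∀ {Z : ℕ → 𝔸}, Tendsto (fun n : ℕ => ((n : ℝ) + 1) • (Z n - 1)) atTop (𝓝 A) →
      ∀ᶠ n : ℕ in atTop, ‖Z n‖ ≤ 1 + b / ((n : ℝ) + 1) := by
    intro Z hZ
    filter_upwards [hZ.norm.eventually (gt_mem_nhds (lt_add_one ‖A‖))] with n hn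
    have hn0 : (0 : ℝ) < (n : ℝ) + 1 := by positivity
    rw [norm_smul, Real.norm_of_nonneg hn0.le] at hn
    have h1 : ‖Z n - 1‖ ≤ b / ((n : ℝ) + 1) := by
      rw [le_div_iff₀ hn0, mul_comm]
      exact hn.le
    calc ‖Z n‖ = ‖1 + (Z n - 1)‖ := by rw [add_sub_cancel]
      _ ≤ ‖(1 : 𝔸)‖ + ‖Z n - 1‖ := norm_add_le _ _
      _ ≤ _ := by rw [norm_one]; linarith
  have hdiff : Tendsto (fun n : ℕ => Real.exp b * ‖((n : ℝ) + 1) • (X n - Y n)‖) atTop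
      (𝓝 0) := by
    have h1 := ((hX.sub hY).norm.const_mul (Real.exp b))
    rw [sub_self, norm_zero, mul_zero] at h1
    refine h1.congr fun n => ?_
    rw [← smul_sub, sub_sub_sub_cancel_right]
  refine squeeze_zero_norm' ?_ hdiff
  filter_upwards [bound hX, bound hY] with n hx hy
  have hn0 : (0 : ℝ) < (n : ℝ) + 1 := by positivity
  have hM : 1 ≤ 1 + b / ((n : ℝ) + 1) := by
    have := div_nonneg hb hn0.le
    linarith
  have hpow : (1 + b / ((n : ℝ) + 1)) ^ (n + 1) ≤ Real.exp b := by
    calc _ ≤ Real.exp (b / ((n : ℝ) + 1)) ^ (n + 1) := by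
          refine pow_le_pow_left₀ (zero_le_one.trans hM) ?_ _
          rw [add_comm]
          exact Real.add_one_le_exp _
      _ = Real.exp b := by
          rw [← Real.exp_nat_mul]
          congr 1
          push_cast
          field_simp
  refine (norm_pow_sub_pow_le hM hx hy (n + 1)).trans ?_
  rw [norm_smul, Real.norm_of_nonneg hn0.le]
  push_cast
  calc _ = (1 + b / ((n : ℝ) + 1)) ^ (n + 1) * (((n : ℝ) + 1) * ‖X n - Y n‖) := by ring
    _ ≤ _ := mul_le_mul_of_nonneg_right hpow (by positivity)

theorem tendsto_natCast_add_one_inv_nhdsNE :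
    Tendsto (fun n : ℕ => ((n : ℝ) + 1)⁻¹) atTop (𝓝[≠] 0) := by
  refine tendsto_nhdsWithin_iff.2 ⟨?_, Eventually.of_forall fun n => ?_⟩
  · simpa [one_div] using tendsto_one_div_add_atTop_nhds_zero_nat (𝕜 := ℝ)
  · have : (0 : ℝ) < (n : ℝ) + 1 := by positivity
    simpa using this.ne'

theorem _root_.HasDerivAt.tendsto_natCast_smul_sub {E : Type*} [NormedAddCommGroup E]
    [NormedSpace ℝ E] {φ : ℝ → E} {φ' : E} (h : HasDerivAt φ φ' 0) :
    Tendsto (fun n : ℕ => ((n : ℝ) + 1) • (φ ((n : ℝ) + 1)⁻¹ - φ 0)) atTop (𝓝 φ') := by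
  have := (hasDerivAt_iff_tendsto_slope_zero.1 h).comp tendsto_natCast_add_one_inv_nhdsNE
  simpa [Function.comp_def] using this

/-- If `n (X n - 1) → A`, then `(X n) ^ n → e ^ A`. -/
theorem tendsto_pow_exp_of_tendsto_smul_sub_one [NormOneClass 𝔸] [NormedAlgebra ℝ 𝔸]
    [NormedAlgebra ℚ 𝔸] [CompleteSpace 𝔸] {X : ℕ → 𝔸} {A : 𝔸}
    (hX : Tendsto (fun n : ℕ => ((n : ℝ) + 1) • (X n - 1)) atTop (𝓝 A)) :
    Tendsto (fun n : ℕ => X n ^ (n + 1)) atTop (𝓝 (NormedSpace.exp A)) := by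
  -- The comparison sequence is `exp (A / (n + 1))`, whose power is exactly `exp A`.
  have hd := (hasDerivAt_exp_smul_const (𝕂 := ℝ) A (0 : ℝ)).tendsto_natCast_smul_sub
  simp only [zero_smul, NormedSpace.exp_zero, one_mul] at hd
  have h := tendsto_pow_sub_pow_zero hX hd
  have e : ∀ n : ℕ, NormedSpace.exp (((n : ℝ) + 1)⁻¹ • A) ^ (n + 1) = NormedSpace.exp A := by
    intro n
    rw [← NormedSpace.exp_nsmul, ← Nat.cast_smul_eq_nsmul ℝ, smul_smul]
    have : (0 : ℝ) < (n : ℝ) + 1 := by positivity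
    push_cast
    rw [mul_inv_cancel₀ this.ne', one_smul]
  simp only [e] at h
  simpa using h.add_const (NormedSpace.exp A)

end ExponentialLimit

/-! ### Matrix powers and traces as sums over paths -/

section PathSum

variable {X : Type*} [Fintype X] [DecidableEq X]

theorem matrix_pow_succ_apply (T : Matrix X X ℂ) (m : ℕ) (σ τ : X) :
    (T ^ (m + 1)) σ τ = ∑ ω : Fin m → X, ∏ t : Fin (m + 1),
      T (Fin.cons (α := fun _ => X) σ ω t) (Fin.snoc (α := fun _ => X) ω τ t) := by
  induction m generalizing σ with
  | zero => simp [Fin.snoc]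
  | succ m ih =>
    rw [pow_succ', Matrix.mul_apply, ← (Fin.consEquiv fun _ => X).sum_comp,
      Fintype.sum_prod_type]
    refine Finset.sum_congr rfl fun ρ _ => ?_
    rw [ih, Finset.mul_sum]
    refine Finset.sum_congr rfl fun ω _ => ?_
    simp only [Fin.consEquiv, Equiv.coe_fn_mk]
    rw [Fin.prod_univ_succ (n := m + 1), ← Fin.cons_snoc_eq_snoc_cons]
    simp

/-- The trace of `f T ^ n` as a sum over closed paths. -/
theorem trace_diagonal_mul_pow (T : Matrix X X ℂ) (f : X → ℂ) (m : ℕ) :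
    (Matrix.diagonal f * T ^ (m + 1)).trace =
      ∑ ω : Fin (m + 1) → X, f (ω 0) * ∏ t, T (ω t) (ω (t + 1)) := by
  rw [← (Fin.consEquiv fun _ => X).sum_comp, Fintype.sum_prod_type, Matrix.trace]
  refine Finset.sum_congr rfl fun σ _ => ?_
  rw [Matrix.diag_apply, Matrix.diagonal_mul, matrix_pow_succ_apply, Finset.mul_sum]
  refine Finset.sum_congr rfl fun ω _ => ?_
  simp only [Fin.consEquiv, Equiv.coe_fn_mk, Fin.cons_zero]
  congr 1
  refine Finset.prod_congr rfl fun t _ => ?_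
  congr 1
  -- At the last time `t + 1` wraps around to 0 in `Fin (m + 1)`, which is how the trace closes the
  -- path.
  induction t using Fin.lastCases with
  | last => simp
  | cast k => simp

end PathSum

/-! ### The transfer matrix and its product formula -/

section Transfer

variable {d : ℕ} {Λ : Finset (Fin d → ℤ)}

/-- The transfer matrix of the time step `x`: a first order approximation of `e^{-xβ𝓗}` with
nonnegative entries that factorize up to the classical energy. -/
noncomputable def transferMatrix (β x : ℝ) (H : Config Λ → ℝ) (field : Λ → ℝ) : Op Λ :=
  Matrix.of fun σ τ => ((Real.exp (-(x * β * H σ)) *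
    ∏ i, (if σ i = τ i then 1 else x * (β * field i)) : ℝ) : ℂ)

theorem siteOp_pauliX_apply (i : Λ) (σ τ : Config Λ) :
    siteOp pauliX i σ τ = (((∏ j ∈ Finset.univ.erase i, if σ j = τ j then (1 : ℝ) else 0) *
      if σ i = τ i then 0 else 1 : ℝ) : ℂ) := by
  rw [siteOp, Matrix.of_apply, ← Finset.prod_erase_mul _ _ (Finset.mem_univ i)]
  push_cast
  congr 1
  · refine Finset.prod_congr rfl fun j hj => ?_
    by_cases h : σ j = τ j <;> simp [Finset.ne_of_mem_erase hj, Matrix.one_apply, h]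
  · by_cases h : σ i = τ i <;> simp [pauliX, h]

/-- The right side has the shape that the product rule gives for the derivative at `x = 0` of the
transfer matrix entries. -/
theorem neg_smul_hamiltonian_apply (β : ℝ) (H : Config Λ → ℝ) (field : Λ → ℝ)
    (σ τ : Config Λ) :
    (-(β : ℂ) • hamiltonian H field) σ τ =
      ((-(β * H σ) * (∏ j, if σ j = τ j then (1 : ℝ) else 0) +
        ∑ i, (∏ j ∈ Finset.univ.erase i, if σ j = τ j then (1 : ℝ) else 0) *
          (if σ i = τ i then 0 else β * field i) : ℝ) : ℂ) := by
  have h1 : (∏ j, if σ j = τ j then (1 : ℝ) else 0) = if σ = τ then 1 else 0 := by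
    rw [Fintype.prod_boole]
    simp [funext_iff]
  have h2 : spinObservable H σ τ = ((H σ * if σ = τ then 1 else 0 : ℝ) : ℂ) := by
    by_cases h : σ = τ <;> simp [spinObservable, h]
  rw [h1, Matrix.smul_apply, hamiltonian, Matrix.sub_apply, Matrix.sum_apply, h2]
  simp only [Matrix.smul_apply, siteOp_pauliX_apply, smul_eq_mul]
  push_cast
  rw [mul_sub, Finset.mul_sum, sub_eq_add_neg, ← Finset.sum_neg_distrib]
  congr 1
  · ring
  · refine Finset.sum_congr rfl fun i _ => ?_
    by_cases h : σ i = τ i <;> simp [h]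
    ring

theorem tendsto_smul_transferMatrix_sub_one (β : ℝ) (H : Config Λ → ℝ) (field : Λ → ℝ) :
    Tendsto (fun n : ℕ => ((n : ℝ) + 1) • (transferMatrix β ((n : ℝ) + 1)⁻¹ H field - 1)) atTop
      (𝓝 (-(β : ℂ) • hamiltonian H field)) := by
  refine tendsto_pi_nhds.2 fun σ => tendsto_pi_nhds.2 fun τ => ?_
  have hprod : HasDerivAt (fun x : ℝ => ∏ i, (if σ i = τ i then 1 else x * (β * field i)))
      (∑ i, (∏ j ∈ Finset.univ.erase i, if σ j = τ j then (1 : ℝ) else 0) *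
          (if σ i = τ i then 0 else β * field i)) 0 := by
    have h : ∀ i ∈ Finset.univ, HasDerivAt
        (fun x : ℝ => if σ i = τ i then (1 : ℝ) else x * (β * field i))
        (if σ i = τ i then 0 else β * field i) 0 := by
      intro i _
      by_cases hi : σ i = τ i
      · simpa [hi] using hasDerivAt_const (0 : ℝ) (1 : ℝ)
      · simpa [hi] using (hasDerivAt_id (0 : ℝ)).mul_const (β * field i)
    simpa using HasDerivAt.fun_finsetProd h
  have hexp : HasDerivAt (fun x : ℝ => Real.exp (-(x * β * H σ))) (-(β * H σ)) 0 := by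
    have h := (((hasDerivAt_id (0 : ℝ)).mul_const β).mul_const (H σ)).fun_neg.exp
    simpa using h
  have hd := (hexp.mul hprod).ofReal_comp.tendsto_natCast_smul_sub
  rw [neg_smul_hamiltonian_apply]
  have h1 : (1 : Op Λ) σ τ = ((Real.exp (-(0 * β * H σ)) *
      ∏ i, (if σ i = τ i then 1 else 0 * (β * field i)) : ℝ) : ℂ) := by
    simp only [zero_mul, neg_zero, Real.exp_zero, one_mul]
    rw [Fintype.prod_boole, Matrix.one_apply]
    simp only [← funext_iff]
    by_cases h : σ = τ <;> simp [h]
  convert hd using 2 with n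
  · rw [Matrix.smul_apply, Matrix.sub_apply, h1]
    rfl
  · simp

theorem tendsto_transferMatrix_pow (β : ℝ) (H : Config Λ → ℝ) (field : Λ → ℝ) :
    Tendsto (fun n : ℕ => transferMatrix β ((n : ℝ) + 1)⁻¹ H field ^ (n + 1)) atTop
      (𝓝 (NormedSpace.exp (-(β : ℂ) • hamiltonian H field))) := by
  open scoped Matrix.Norms.Operator in
  exact tendsto_pow_exp_of_tendsto_smul_sub_one (tendsto_smul_transferMatrix_sub_one β H field)

end Transfer

/-! ### The classical model of interacting paths -/

section PathModel

variable {d : ℕ} {Λ : Finset (Fin d → ℤ)}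

/-- The weight of a discretized closed path of the spin at `i`. -/
noncomputable def pathWeight (β x : ℝ) (field : Λ → ℝ) (m : ℕ) (i : Λ)
    (s : Fin (m + 1) → ℤˣ) : ℝ :=
  ∏ t, if s t = s (t + 1) then 1 else x * (β * field i)

/-- The classical energy of a family of discretized paths. -/
noncomputable def pathEnergy (β x : ℝ) (H : Config Λ → ℝ) (m : ℕ)
    (ω : Λ → Fin (m + 1) → ℤˣ) : ℝ :=
  ∑ t, x * β * H fun i => ω i t

/-- Paths of configurations are reread as configurations of paths. The spin-flip factors then split
over sites into the reference weights, and only the classical energy couples them. -/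
theorem trace_spinObservable_mul_transferMatrix_pow (β x : ℝ) (H : Config Λ → ℝ)
    (field : Λ → ℝ) (f : Config Λ → ℝ) (m : ℕ) :
    (spinObservable f * transferMatrix β x H field ^ (m + 1)).trace =
      ((∑ ω, gibbsWeight (pathWeight β x field m) (pathEnergy β x H m) ω *
        f (fun i => ω i 0) : ℝ) : ℂ) := by
  rw [spinObservable, trace_diagonal_mul_pow,
    ← (Equiv.piComm fun (_ : Λ) (_ : Fin (m + 1)) => ℤˣ).sum_comp, Complex.ofReal_sum]
  refine Finset.sum_congr rfl fun ω _ => ?_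
  rw [mul_comm, Complex.ofReal_mul]
  congr 1
  simp only [gibbsWeight, pathWeight, pathEnergy, transferMatrix, Matrix.of_apply,
    Equiv.piComm_apply, swap]
  rw [← Complex.ofReal_prod, Finset.prod_mul_distrib, ← Real.exp_sum, Finset.sum_neg_distrib,
    Finset.prod_comm]
  rfl

theorem trace_transferMatrix_pow (β x : ℝ) (H : Config Λ → ℝ) (field : Λ → ℝ) (m : ℕ) :
    (transferMatrix β x H field ^ (m + 1)).trace =
      ((∑ ω, gibbsWeight (pathWeight β x field m) (pathEnergy β x H m) ω : ℝ) : ℂ) := by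
  have h := trace_spinObservable_mul_transferMatrix_pow β x H field (fun _ => 1) m
  have h1 : (spinObservable fun _ : Config Λ => (1 : ℝ)) = 1 := by simp [spinObservable]
  simpa only [h1, one_mul, mul_one] using h

theorem pathWeight_nonneg {β x : ℝ} {field : Λ → ℝ} (hβ : 0 ≤ β) (hx : 0 ≤ x)
    (hf : ∀ i, 0 ≤ field i) (m : ℕ) (i : Λ) (s : Fin (m + 1) → ℤˣ) :
    0 ≤ pathWeight β x field m i s :=
  Finset.prod_nonneg fun t _ => by
    split_ifs
    · exact zero_le_one
    · exact mul_nonneg hx (mul_nonneg hβ (hf i))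

theorem pathWeight_const (β x : ℝ) (field : Λ → ℝ) (m : ℕ) (i : Λ) (u : ℤˣ) :
    pathWeight β x field m i (fun _ => u) = 1 := by
  simp [pathWeight]

/-- The partition function of the path model dominates the contribution of constant paths. -/
theorem exp_le_sum_gibbsWeight {β : ℝ} {field : Λ → ℝ} (hβ : 0 ≤ β) (hf : ∀ i, 0 ≤ field i)
    (H : Config Λ → ℝ) (m : ℕ) (σ : Config Λ) :
    Real.exp (-(β * H σ)) ≤
      ∑ ω, gibbsWeight (pathWeight β ((m : ℝ) + 1)⁻¹ field m)
        (pathEnergy β ((m : ℝ) + 1)⁻¹ H m) ω := by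
  have hm : (0 : ℝ) < (m : ℝ) + 1 := by positivity
  refine le_trans (le_of_eq ?_) (Finset.single_le_sum
    (fun ω _ => gibbsWeight_nonneg (pathWeight_nonneg hβ (inv_nonneg.2 hm.le) hf m) ω)
    (Finset.mem_univ fun i _ => σ i))
  simp only [gibbsWeight, pathWeight_const, pathEnergy, Finset.prod_const_one, mul_one,
    Finset.sum_const, Finset.card_univ, Fintype.card_fin, nsmul_eq_mul]
  congr 2
  push_cast
  field_simp

theorem unit_eq_or_eq_neg (a b : ℤˣ) : a = b ∨ a = -b := by
  rcases Int.units_eq_one_or a with rfl | rfl <;> rcases Int.units_eq_one_or b with rfl | rfl <;>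
    simp

theorem abs_update_sub_le_norm_grad (f : Config Λ → ℝ) (i : Λ) (σ : Config Λ) (a : ℤˣ) :
    |f (update σ i a) - f σ| ≤ ‖grad i f‖ := by
  rcases unit_eq_or_eq_neg a (σ i) with rfl | rfl
  · simp
  · exact norm_le_pi_norm (grad i f) σ

theorem siteOsc_eval_zero_le (f : Config Λ → ℝ) (m : ℕ) (i : Λ) :
    siteOsc i (fun ω : Λ → Fin (m + 1) → ℤˣ => f fun j => ω j 0) ≤ ‖grad i f‖ := by
  refine siteOsc_le (norm_nonneg _) fun ω s => ?_
  have h : (fun j => update ω i s j 0) = update (fun j => ω j 0) i (s 0) := by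
    funext j
    by_cases hj : j = i
    · subst hj; simp
    · simp [hj]
  rw [h]
  exact abs_update_sub_le_norm_grad _ _ _ _

/-- The mixed second differences of the classical energy. -/
theorem abs_mixed_difference_le {H : Config Λ → ℝ} {C R : ℝ} (hC : ∀ i σ, |grad i H σ| ≤ C)
    (hLOC : Locality H R) (i j : Λ) (hij : j ≠ i) (σ : Config Λ) (v a b : ℤˣ) :
    |(H (update (update σ j v) i a) - H (update (update σ j v) i b)) -
      (H (update σ i a) - H (update σ i b))| ≤
      if latticeDist (j : Fin d → ℤ) i ≤ R then 2 * C else 0 := by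
  have hC0 : 0 ≤ C := (abs_nonneg _).trans (hC i σ)
  rcases unit_eq_or_eq_neg a b with rfl | rfl
  · simp only [sub_self, abs_zero]
    split_ifs <;> linarith
  · have hg : ∀ τ : Config Λ, H (update τ i (-b)) - H (update τ i b) =
        grad i H (update τ i b) := by
      intro τ
      simp [grad, flipSpin]
    rw [hg, hg]
    split_ifs with h
    · have := hC i (update (update σ j v) i b)
      have := hC i (update σ i b)
      refine (abs_sub _ _).trans ?_
      linarith
    -- The two configurations differ at most at `j`, which lies outside the range of `∇_i H`.
    · rw [hLOC i (update (update σ j v) i b) (update σ i b), sub_self, abs_zero]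
      intro k hk
      by_cases hki : k = i
      · subst hki; simp
      · have hkj : k ≠ j := by
          rintro rfl
          exact h hk
        simp [hki, hkj]

/-- Each of the `m + 1` time slices contributes at most `β / (m + 1)` times the mixed difference of
`H`, so the bound does not depend on the discretization. -/
theorem abs_mixed_difference_pathEnergy_le {H : Config Λ → ℝ} {β C R : ℝ} (hβ : 0 ≤ β)
    (hC : ∀ i σ, |grad i H σ| ≤ C) (hLOC : Locality H R) (m : ℕ) (i j : Λ) (hij : j ≠ i)
    (ω : Λ → Fin (m + 1) → ℤˣ) (v a b : Fin (m + 1) → ℤˣ) :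
    |(pathEnergy β ((m : ℝ) + 1)⁻¹ H m (update (update ω j v) i a) -
        pathEnergy β ((m : ℝ) + 1)⁻¹ H m (update (update ω j v) i b)) -
      (pathEnergy β ((m : ℝ) + 1)⁻¹ H m (update ω i a) -
        pathEnergy β ((m : ℝ) + 1)⁻¹ H m (update ω i b))| ≤
      β * if latticeDist (j : Fin d → ℤ) i ≤ R then 2 * C else 0 := by
  have hm : (0 : ℝ) < (m : ℝ) + 1 := by positivity
  have hslice : ∀ (η : Λ → Fin (m + 1) → ℤˣ) (k : Λ) (s : Fin (m + 1) → ℤˣ) (t : Fin (m + 1)),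
      (fun l => update η k s l t) = update (fun l => η l t) k (s t) := by
    intro η k s t
    funext l
    by_cases hl : l = k
    · subst hl; simp
    · simp [hl]
  simp only [pathEnergy, hslice, ← Finset.sum_sub_distrib, ← mul_sub]
  calc _ ≤ ∑ _t : Fin (m + 1), ((m : ℝ) + 1)⁻¹ * β *
        (if latticeDist (j : Fin d → ℤ) i ≤ R then 2 * C else 0) := by
        refine (Finset.abs_sum_le_sum_abs _ _).trans (Finset.sum_le_sum fun t _ => ?_)
        have hx : 0 ≤ ((m : ℝ) + 1)⁻¹ * β := mul_nonneg (inv_nonneg.2 hm.le) hβ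
        rw [abs_mul, abs_of_nonneg hx]
        exact mul_le_mul_of_nonneg_left (abs_mixed_difference_le hC hLOC i j hij _ _ _ _) hx
    _ = _ := by
        simp only [Finset.sum_const, Finset.card_univ, Fintype.card_fin, nsmul_eq_mul]
        push_cast
        field_simp

end PathModel

/-! ### Exponential decay in the path model and the quantum limit -/

section Decay

variable {d : ℕ} {Λ : Finset (Fin d → ℤ)}

/-- In `γ > 0` the first term is at most 1 and the maximum is at least 1; the exponent `3βC`
dominates `2βC`. -/
theorem influence_le {β C lam R : ℝ} (hβ : 0 < β) (hC : 0 < C) (hR : 0 < R)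
    (hγ : 0 < gammaConst d β C lam R) :
    (2 * R) ^ d * (Real.exp (β * (2 * C)) - 1) ≤ 1 / 5 := by
  have hβC : 0 < β * C := mul_pos hβ hC
  have h1 : Real.exp (-2 * β * C) ≤ 1 := Real.exp_le_one_iff.2 (by nlinarith)
  have h2 : Real.exp (β * (2 * C)) ≤ Real.exp (3 * β * C) := Real.exp_le_exp.2 (by nlinarith)
  have h3 : 0 ≤ (2 * R) ^ d * (Real.exp (β * (2 * C)) - 1) := mul_nonneg (by positivity)
    (sub_nonneg.2 (Real.one_le_exp (by nlinarith)))
  have h4 : (2 * R) ^ d * (Real.exp (β * (2 * C)) - 1) ≤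
      (2 * R) ^ d * (Real.exp (3 * β * C) - 1) :=
    mul_le_mul_of_nonneg_left (by linarith) (by positivity)
  have h5 : 1 ≤ max 1 (β * lam) := le_max_left _ _
  have h6 := mul_le_mul_of_nonneg_right h5 (h3.trans h4)
  unfold gammaConst at hγ
  nlinarith

/-- For `d ≥ 1` the factor `1/2` costs 2, below every base of the power. For `d = 0` one has `N =
1`, which forces the contraction factor 0. -/
theorem inv_one_sub_le_prefactorConst {R : ℝ} (hR : 0 < R) :
    (1 - if d = 0 then (0 : ℝ) else 1 / 2)⁻¹ ≤ prefactorConst d R := by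
  have he : Real.exp (-1 / R) < 1 := Real.exp_lt_one_iff.2 (div_neg_of_neg_of_pos (by norm_num) hR)
  have he0 := Real.exp_pos (-1 / R)
  have h2 : 2 ≤ 2 / (1 - Real.exp (-1 / R)) := by
    rw [le_div_iff₀ (by linarith)]
    linarith
  unfold prefactorConst
  split_ifs with h
  · subst h; simp
  · calc (1 - 1 / 2 : ℝ)⁻¹ = 2 := by norm_num
      _ ≤ 2 / (1 - Real.exp (-1 / R)) := h2
      _ ≤ _ := le_self_pow₀ (by linarith) h

theorem decayRate_le {β C lam R : ℝ} (hR : 0 < R) : decayRate d β C lam R ≤ 1 / (4 * R) := by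
  calc _ ≤ 1 / (2 * R) * (1 / 2) :=
        mul_le_mul_of_nonneg_left (min_le_left _ _) (by positivity)
    _ = _ := by field_simp; norm_num

/-- A step of length at most `R` multiplies the weight by at most `e^{1/4} ≤ 5/2`, and the total
influence is at most `1/5`. -/
theorem sum_weight_mul_influence_le {β C lam R : ℝ} (hβ : 0 < β) (hC : 0 < C) (hR : 0 < R)
    (hγ : 0 < gammaConst d β C lam R) (A : Set Λ) (i : Λ) :
    ∑ j : Λ, Real.exp (1 / (4 * R) * setDist A {j}) *
        (if j ≠ i ∧ latticeDist (j : Fin d → ℤ) i ≤ R then Real.exp (β * (2 * C)) - 1 else 0) ≤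
      (if d = 0 then 0 else 1 / 2) * Real.exp (1 / (4 * R) * setDist A {i}) := by
  split_ifs with hd
  · subst hd
    refine (Finset.sum_nonpos fun j _ => ?_).trans_eq (zero_mul _).symm
    have : j = i := Subsingleton.elim _ _
    simp [this]
  set c := Real.exp (β * (2 * C)) - 1 with hc
  set ρ := Real.exp (1 / (4 * R) * setDist A {i}) with hρ
  have hc0 : 0 ≤ c := sub_nonneg.2 (Real.one_le_exp (by positivity))
  have hquarter : Real.exp (1 / 4) ≤ 5 / 2 := by
    have h1 : Real.exp (1 / 4) ≤ Real.exp (1 / 2) := Real.exp_le_exp.2 (by norm_num)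
    have h2 := Real.exp_bound_div_one_sub_of_interval (x := 1 / 2) (by norm_num) (by norm_num)
    norm_num at h2
    linarith
  calc _ ≤ ∑ j : Λ, if j ≠ i ∧ latticeDist (j : Fin d → ℤ) i ≤ R
          then Real.exp (1 / 4) * ρ * c else 0 := by
        refine Finset.sum_le_sum fun j _ => ?_
        split_ifs with hj
        · refine mul_le_mul_of_nonneg_right ?_ hc0
          rw [hρ, ← Real.exp_add, Real.exp_le_exp]
          have h1 := setDist_singleton_le_add A i j
          have h2 : latticeDist (i : Fin d → ℤ) j ≤ R := by
            simpa only [latticeDist, abs_sub_comm] using hj.2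
          have h3 : 1 / (4 * R) * R = 1 / 4 := by field_simp
          have h4 : 0 ≤ 1 / (4 * R) := by positivity
          calc _ ≤ 1 / (4 * R) * (setDist A {i} + R) :=
                mul_le_mul_of_nonneg_left (by linarith) h4
            _ = _ := by rw [mul_add, h3, add_comm]
        · simp
    _ = (Finset.univ.filter fun j : Λ => j ≠ i ∧ latticeDist (j : Fin d → ℤ) i ≤ R).card *
          (Real.exp (1 / 4) * ρ * c) := by
        rw [← Finset.sum_filter, Finset.sum_const, nsmul_eq_mul]
    _ ≤ (2 * R) ^ d * (Real.exp (1 / 4) * ρ * c) :=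
        mul_le_mul_of_nonneg_right (card_neighbours_le hR Λ i) (by positivity)
    _ = Real.exp (1 / 4) * ((2 * R) ^ d * c) * ρ := by ring
    _ ≤ 5 / 2 * (1 / 5) * ρ := by
        have := influence_le hβ hC hR hγ
        gcongr
    _ = 1 / 2 * ρ := by norm_num

/-- Exponential decay of covariances in the path model, uniformly in the discretization. -/
theorem abs_weightedCov_pathModel_le {β C lam R : ℝ} (hβ : 0 < β) (hC : 0 < C) (hR : 0 < R)
    (hγ : 0 < gammaConst d β C lam R) {H : Config Λ → ℝ} {field : Λ → ℝ}
    (hBD : BoundedDifferences H field C lam) (hLOC : Locality H R) (f g : Config Λ → ℝ) (m : ℕ) :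
    |weightedCov (gibbsProb (pathWeight β ((m : ℝ) + 1)⁻¹ field m)
        (pathEnergy β ((m : ℝ) + 1)⁻¹ H m)) (fun ω => f fun i => ω i 0)
          (fun ω => g fun i => ω i 0)| ≤
      prefactorConst d R * tripleNorm f * tripleNorm g *
        Real.exp (-decayRate d β C lam R * setDist (supportSites f) (supportSites g)) := by
  have hm : (0 : ℝ) < (m : ℝ) + 1 := by positivity
  have hp := pathWeight_nonneg hβ.le (inv_nonneg.2 hm.le) (fun i => (hBD.2 i).1) m
  have hp' : ∀ i, ∃ s, 0 < pathWeight β ((m : ℝ) + 1)⁻¹ field m i s := fun i =>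
    ⟨fun _ => 1, by rw [pathWeight_const]; exact one_pos⟩
  set κ := 1 / (4 * R) with hκ
  have hκ0 : 0 ≤ κ := by positivity
  set D := setDist (supportSites f) (supportSites g) with hD
  have hf0 : 0 ≤ tripleNorm f := Finset.sum_nonneg fun i _ => norm_nonneg _
  have hg0 : 0 ≤ tripleNorm g := Finset.sum_nonneg fun i _ => norm_nonneg _
  have hc0 : 0 ≤ Real.exp (β * (2 * C)) - 1 := sub_nonneg.2 (Real.one_le_exp (by positivity))
  have hcov := (gibbsKernel (E := pathEnergy β ((m : ℝ) + 1)⁻¹ H m) hp hp').abs_weightedCov_le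
    (gibbsProb_nonneg hp) (sum_gibbsProb hp hp')
    (c := fun i j => if j ≠ i ∧ latticeDist (j : Fin d → ℤ) i ≤ R
      then Real.exp (β * (2 * C)) - 1 else 0)
    (ρ := fun j => Real.exp (κ * setDist (supportSites f) {j}))
    -- A site of `Λ_g` is at distance at least `D` from `Λ_f`, so `e^{-κD} ρ_i ≥ 1` there; off `Λ_g`
    -- the oscillation of `g` vanishes. This `B` carries the decay.
    (a := if d = 0 then 0 else 1 / 2) (B := Real.exp (-κ * D) * tripleNorm g)
    (fun i j => by split_ifs <;> simp [hc0])
    (fun i => Real.one_le_exp (mul_nonneg hκ0 (setDist_nonneg _ _)))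
    (by split_ifs <;> norm_num) (by split_ifs <;> norm_num)
    (mul_nonneg (Real.exp_pos _).le hg0)
    (fun i j hij ω v => by
      have hdiff := abs_mixed_difference_pathEnergy_le hβ.le hBD.1 hLOC m i j hij ω v
      refine (sum_abs_gibbsKernel_sub_le hp hp'
        (mul_nonneg hβ.le (by split_ifs <;> linarith)) hdiff).trans ?_
      by_cases h : latticeDist (j : Fin d → ℤ) i ≤ R <;> simp [hij, h])
    (fun i => sum_weight_mul_influence_le hβ hC hR hγ (supportSites f) i)
    (fun ω => f fun i => ω i 0) (fun ω => g fun i => ω i 0)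
    (fun i => by
      refine (siteOsc_eval_zero_le g m i).trans ?_
      by_cases hi : i ∈ supportSites g
      · calc ‖grad i g‖ ≤ tripleNorm g := Finset.single_le_sum
              (f := fun i => ‖grad i g‖) (fun _ _ => norm_nonneg _) (Finset.mem_univ i)
          _ ≤ Real.exp (-κ * D + κ * setDist (supportSites f) {i}) * tripleNorm g := by
              refine le_mul_of_one_le_left hg0 (Real.one_le_exp ?_)
              have := mul_le_mul_of_nonneg_left
                (setDist_le_singleton (A := supportSites f) hi) hκ0
              linarith
          _ = _ := by rw [Real.exp_add]; ring
      · have h0 : ‖grad i g‖ = 0 := le_antisymm (not_lt.1 hi) (norm_nonneg _)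
        rw [h0]
        positivity)
  -- The weights cost nothing on the side of `f`: they equal 1 on `Λ_f`, and off it the oscillation
  -- is 0.
  have hsum : ∑ i, Real.exp (κ * setDist (supportSites f) {i}) *
      siteOsc i (fun ω : Λ → Fin (m + 1) → ℤˣ => f fun i => ω i 0) ≤ tripleNorm f := by
    refine Finset.sum_le_sum fun i _ => ?_
    have h1 := siteOsc_eval_zero_le f m i
    by_cases hi : i ∈ supportSites f
    · rw [setDist_singleton_of_mem hi, mul_zero, Real.exp_zero, one_mul]
      exact h1
    · have h0 : ‖grad i f‖ = 0 := le_antisymm (not_lt.1 hi) (norm_nonneg _)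
      rw [le_antisymm (h1.trans_eq h0) (siteOsc_nonneg _ _), mul_zero]
      exact norm_nonneg _
  have ha : (0 : ℝ) < 1 - if d = 0 then 0 else 1 / 2 := by split_ifs <;> norm_num
  have hN := inv_one_sub_le_prefactorConst (d := d) hR
  have hN0 : 0 ≤ prefactorConst d R := (inv_pos.2 ha).le.trans hN
  have hexp : Real.exp (-κ * D) ≤ Real.exp (-decayRate d β C lam R * D) := by
    refine Real.exp_le_exp.2 (mul_le_mul_of_nonneg_right ?_ (setDist_nonneg _ _))
    exact neg_le_neg (decayRate_le hR)
  calc _ ≤ _ := hcov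
    _ ≤ Real.exp (-κ * D) * tripleNorm g / (1 - if d = 0 then 0 else 1 / 2) * tripleNorm f :=
        mul_le_mul_of_nonneg_left hsum
          (div_nonneg (mul_nonneg (Real.exp_pos _).le hg0) ha.le)
    _ = (1 - if d = 0 then (0 : ℝ) else 1 / 2)⁻¹ * tripleNorm f * tripleNorm g *
          Real.exp (-κ * D) := by rw [div_eq_mul_inv]; ring
    _ ≤ _ := by gcongr

theorem tendsto_weightedCov_pathModel {β : ℝ} (hβ : 0 < β) {H : Config Λ → ℝ} {field : Λ → ℝ}
    (hfield : ∀ i, 0 ≤ field i) (f g : Config Λ → ℝ) :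
    Tendsto (fun m : ℕ => ((weightedCov (gibbsProb (pathWeight β ((m : ℝ) + 1)⁻¹ field m)
        (pathEnergy β ((m : ℝ) + 1)⁻¹ H m)) (fun ω => f fun i => ω i 0)
          (fun ω => g fun i => ω i 0) : ℝ) : ℂ)) atTop
      (𝓝 (truncatedCorrelation β (hamiltonian H field) (spinObservable f)
        (spinObservable g))) := by
  set T : ℕ → Op Λ := fun m => transferMatrix β ((m : ℝ) + 1)⁻¹ H field ^ (m + 1) with hT
  have hlim := tendsto_transferMatrix_pow β H field
  have htr : Tendsto (fun m => (T m).trace) atTop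
      (𝓝 (NormedSpace.exp (-(β : ℂ) • hamiltonian H field)).trace) :=
    (Continuous.matrix_trace continuous_id).continuousAt.tendsto.comp hlim
  have hobs : ∀ F : Op Λ, Tendsto (fun m => (F * T m).trace) atTop
      (𝓝 (F * NormedSpace.exp (-(β : ℂ) • hamiltonian H field)).trace) := fun F =>
    (Continuous.matrix_trace
      (continuous_const.matrix_mul continuous_id)).continuousAt.tendsto.comp hlim
  -- The constant paths with all spins 1 bound the discrete partition functions below by a positive
  -- number independent of `m`, so the limit cannot vanish.
  have hne : (NormedSpace.exp (-(β : ℂ) • hamiltonian H field)).trace ≠ 0 := by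
    intro h0
    rw [h0] at htr
    have hre := (Complex.continuous_re.tendsto _).comp htr
    have h1 : Real.exp (-(β * H fun _ => 1)) ≤ (0 : ℂ).re := by
      refine ge_of_tendsto' hre fun m => ?_
      simp only [hT, comp_apply, trace_transferMatrix_pow, Complex.ofReal_re]
      exact exp_le_sum_gibbsWeight hβ.le hfield H m _
    exact absurd (Real.exp_pos _) (not_lt.2 h1)
  have havg : ∀ F : Op Λ, Tendsto (fun m => (F * T m).trace / (T m).trace) atTop
      (𝓝 (quantumAverage β (hamiltonian H field) F)) := fun F => (hobs F).div htr hne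
  have hmul : spinObservable f * spinObservable g = spinObservable fun σ => f σ * g σ := by
    simp [spinObservable, Matrix.diagonal_mul_diagonal]
  have h := (havg (spinObservable f * spinObservable g)).sub
    ((havg (spinObservable f)).mul (havg (spinObservable g)))
  refine h.congr fun m => ?_
  rw [weightedCov_gibbsProb, hmul]
  simp only [hT, trace_transferMatrix_pow, trace_spinObservable_mul_transferMatrix_pow]
  push_cast
  rfl

end Decay

end TransverseField

theorem theorem2p1 {d : ℕ} (β C lam R : ℝ) (hβ : 0 < β) (hC : 0 < C) (hlam : 0 < lam)
    (hR : 0 < R) (hγ : 0 < TransverseField.gammaConst d β C lam R)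
    (Λ : Finset (Fin d → ℤ)) (H : TransverseField.Config Λ → ℝ) (field : Λ → ℝ)
    (hBD : TransverseField.BoundedDifferences H field C lam)
    (hLOC : TransverseField.Locality H R)
    (f g : TransverseField.Config Λ → ℝ) :
    ‖TransverseField.truncatedCorrelation β (TransverseField.hamiltonian H field)
        (TransverseField.spinObservable f) (TransverseField.spinObservable g)‖ ≤
      (‖f‖ * ‖g‖ + TransverseField.prefactorConst d R *
          TransverseField.tripleNorm f * TransverseField.tripleNorm g) *
        Real.exp (-TransverseField.decayRate d β C lam R *
          TransverseField.setDist (TransverseField.supportSites f)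
            (TransverseField.supportSites g)) := by
  have hlim := TransverseField.tendsto_weightedCov_pathModel hβ (H := H)
    (fun i => (hBD.2 i).1) f g
  refine le_of_tendsto' hlim.norm fun m => ?_
  rw [Complex.norm_real]
  refine (TransverseField.abs_weightedCov_pathModel_le hβ hC hR hγ hBD hLOC f g m).trans ?_
  -- The path model already gives the bound without `‖f‖ * ‖g‖`, a nonnegative term that only
  -- enlarges the right side.
  exact mul_le_mul_of_nonneg_right
    (le_add_of_nonneg_left (mul_nonneg (norm_nonneg f) (norm_nonneg g))) (Real.exp_pos _).le
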